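/- Let $\mathcal M$ be a compact smooth $m$-dimensional manifold without boundary, smoothly embedded in the Euclidean space $\mathbb R^N$ and equipped with the induced Riemannian metric ($\mathcal M$ need not be connected). The medial axis of $\mathcal M$ is the closure of the set of points of $\mathbb R^N$ that have more than one nearest point on $\mathcal M$, and the local feature size $\mathrm{lfs}(x)$ of $x\in\mathcal M$ is the distance from $x$ to the medial axis (it is $+\infty$ if the medial axis is empty, with the convention $0\cdot\infty=0$). For linear subspaces $U,V$ of $\mathbb R^N$ of equal dimension, let $$\angle(U,V)=\max_{u\in U,\ \|u\|=1}\ \min_{v\in V,\ \|v\|=1}\angle(u,v)$$ be the largest principal angle between them (it is $0$ if $U=V=\{0\}$). For $p\in\mathcal M$ let $T_p\mathcal M\subseteq\mathbb R^N$ be the tangent space of $\mathcal M$ at $p$, as a linear subspace. Put $$f(t)=\frac{(2+3t+2t^2)^2+4t+5}{2-2t}.$$ (i) For all $p,q\in\mathcal M$ and $0\le t\le \tfrac14$ with $\|p-q\|=t\,\mathrm{lfs}(p)$, $$\sin\angle(T_p\mathcal M,T_q\mathcal M)\le t\,f(t).$$ Moreover $f(t)=\tfrac92+O(t)$ as $t\to0$,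 and $f(t)<6$ for $0\le t\le\tfrac1{10}$. (ii) There is an absolute constant $C$, independent of $m$, $N$, $\mathcal M$, $p$, $q$ and $t$, such that for all $p,q\in\mathcal M$ and $0\le t\le\tfrac{19}{200}$ with $\|p-q\|=t\,\mathrm{lfs}(p)$, $$\sin\angle(T_p\mathcal M,T_q\mathcal M)\le 3t+C\,t^2.$$ -/

import Mathlib

open Manifold Topology
open scoped ContDiff ENNReal

namespace TangentVariation

noncomputable section

/-- The medial axis of a set `S`: the closure of the set of points that have more than one
nearest neighbour on `S`. -/
def medialAxis {E : Type*} [PseudoMetricSpace E] (S : Set E) : Set E :=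
  closure {x | ∃ a ∈ S, ∃ b ∈ S, a ≠ b ∧ dist x a = Metric.infDist x S ∧
    dist x b = Metric.infDist x S}

/-- The local feature size of `S` at `x`: the distance from `x` to the medial axis of `S`
(with value `∞` if the medial axis is empty, for example if `S` is a single point). -/
def lfs {E : Type*} [PseudoMetricSpace E] (S : Set E) (x : E) : ℝ≥0∞ :=
  Metric.infEDist x (medialAxis S)

/-- The angle between two subspaces (used here for subspaces of equal dimension): the maximum
over unit vectors `u ∈ U` of the minimum over unit vectors `v ∈ V` of the angle between `u` and
`v`. It is `0` if `U` is the zero space. -/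
def subspaceAngle {E : Type*} [NormedAddCommGroup E] [InnerProductSpace ℝ E]
    (U V : Submodule ℝ E) : ℝ :=
  ⨆ u : {u : E // u ∈ U ∧ ‖u‖ = 1}, ⨅ v : {v : E // v ∈ V ∧ ‖v‖ = 1},
    InnerProductGeometry.angle (u : E) (v : E)

/-- The tangent space at `p` of the submanifold `ι(M)` of `ℝ^N`, as a linear subspace of `ℝ^N`:
the image of the differential of the inclusion `ι`. -/
def tangentSubspace {m N : ℕ} {M : Type*} [TopologicalSpace M]
    [ChartedSpace (EuclideanSpace ℝ (Fin m)) M]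
    (ι : M → EuclideanSpace ℝ (Fin N)) (p : M) : Submodule ℝ (EuclideanSpace ℝ (Fin N)) :=
  LinearMap.range (M := EuclideanSpace ℝ (Fin m)) (M₂ := EuclideanSpace ℝ (Fin N))
    (mfderiv (𝓡 m) (𝓡 N) ι p).toLinearMap

/-- The function `f(t) = ((2 + 3t + 2t²)² + 4t + 5) / (2 - 2t)`. -/
def f (t : ℝ) : ℝ := ((2 + 3 * t + 2 * t ^ 2) ^ 2 + 4 * t + 5) / (2 - 2 * t)

end

end TangentVariation

/-! Both inequalities follow from the sharper bound `3 / 2 * t`, valid for t ≤ 1/4; the constant C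
can then be 0. Federer's argument shows that empty balls tangent at x persist up to the distance L'
from x to the medial axis: 2L'⟨z - x, n⟩ ≤ ‖z - x‖² for z on the manifold and unit normals n at x
(`two_mul_inner_le`). Near x, this bounds the second fundamental form by 1/L', so the tangent spaces
turn with speed at most 1/L'. For z = p, it says that p - x is nearly tangent at x. Fix a unit
vector u tangent at p, and let L be the local feature size at p. On the points x no farther from p
than q, maximize ‖N_x u‖ - 3/(2L)‖x - p‖, where N_x projects onto the normal space. At x ≠ p, a
small move along the tangential part of p - x approaches p fast enough, relative to the turning of
the tangent space, to increase this function (`IsLocalParam.exists_closer`). So the maximum is at p,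
where the value is 0. Only infinitesimal moves occur, hence no geodesics and no connectedness are
needed. -/

namespace TangentVariation

/-! ### Empty tangent balls and the medial axis -/

section EmptyBall

open Metric

variable {F : Type*} [NormedAddCommGroup F]

/-- If `a` is the only nearest point of `y` on a compact set, then the nearest points of points
close to `y` are close to `a`. -/
lemma exists_forall_nearest_dist_lt {S : Set F} (hS : IsCompact S) {y a : F}
    (huniq : ∀ w ∈ S, dist y w = infDist y S → w = a) {δ : ℝ} (hδ : 0 < δ) :
    ∃ η > 0, ∀ z, dist z y < η → ∀ w ∈ S, dist z w = infDist z S → dist w a < δ := by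
  have hK : IsCompact (S ∩ {w | δ ≤ dist w a}) :=
    hS.inter_right (isClosed_le continuous_const (by fun_prop))
  rcases (S ∩ {w | δ ≤ dist w a}).eq_empty_or_nonempty with he | hne
  · refine ⟨1, one_pos, fun z _ w hw _ => ?_⟩
    by_contra! h
    exact (Set.eq_empty_iff_forall_notMem.1 he) w ⟨hw, h⟩
  · obtain ⟨b, hb, hmin⟩ := hK.exists_isMinOn hne (f := fun w => dist y w) (by fun_prop)
    have hlt : infDist y S < dist y b := by
      refine lt_of_le_of_ne (infDist_le_dist_of_mem hb.1) fun h => ?_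
      have h1 := hb.2
      rw [huniq b hb.1 h.symm] at h1
      simp at h1
      linarith
    refine ⟨(dist y b - infDist y S) / 2, by linarith, fun z hz w hw hzw => ?_⟩
    by_contra! h
    have h1 : dist y b ≤ dist y w := hmin ⟨hw, h⟩
    have h2 : infDist z S ≤ infDist y S + dist z y := infDist_le_infDist_add_dist
    have h3 : dist y w ≤ dist z y + dist z w := by
      rw [dist_comm z y]; exact dist_triangle _ _ _
    linarith

variable [InnerProductSpace ℝ F]

/-- The distance to `S` grows at unit rate in the direction leading away from a unique nearest
point. Nearest points w of a slightly displaced point stay near `a`, so y - w is almost parallel to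
y - a; testing against the unit vector along y - w gives any rate c < 1. -/
lemma exists_forall_infDist_add_smul_ge {S : Set F} (hS : IsCompact S) {y a : F} (ha : a ∈ S)
    (hya : dist y a = infDist y S) (hpos : 0 < infDist y S)
    (huniq : ∀ w ∈ S, dist y w = infDist y S → w = a) {c : ℝ} (hc : c < 1) :
    ∃ η > 0, ∀ h, 0 < h → h < η →
      infDist y S + c * h ≤ infDist (y + h • ((dist y a)⁻¹ • (y - a))) S := by
  set ν := (dist y a)⁻¹ • (y - a) with hν
  have hd : 0 < ‖y - a‖ := by rw [← dist_eq_norm, hya]; exact hpos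
  have hν1 : ‖ν‖ = 1 := by
    rw [hν, norm_smul, dist_eq_norm, norm_inv, norm_norm, inv_mul_cancel₀ hd.ne']
  have hcont : ContinuousAt (fun w => inner ℝ ν (‖y - w‖⁻¹ • (y - w))) a := by
    have : ContinuousAt (fun w => ‖y - w‖⁻¹) a :=
      ContinuousAt.inv₀ (by fun_prop) hd.ne'
    exact ContinuousAt.inner continuousAt_const (this.smul (by fun_prop))
  have hval : inner ℝ ν (‖y - a‖⁻¹ • (y - a)) = (1 : ℝ) := by
    rw [← dist_eq_norm, ← hν, real_inner_self_eq_norm_sq, hν1]; norm_num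
  have hev := hcont.eventually (lt_mem_nhds (a := c) (hc.trans_eq hval.symm))
  obtain ⟨δ, hδ, hδ'⟩ := Metric.eventually_nhds_iff.1 hev
  obtain ⟨η, hη, hη'⟩ := exists_forall_nearest_dist_lt hS huniq hδ
  refine ⟨η, hη, fun h h0 h1 => ?_⟩
  obtain ⟨w, hw, hzw⟩ := hS.exists_infDist_eq_dist ⟨a, ha⟩ (y + h • ν)
  have hwa := hη' (y + h • ν) (by simp [dist_eq_norm, norm_smul, hν1, abs_of_pos h0, h1]) w hw
    hzw.symm
  have hcw := hδ' hwa
  have hyw : 0 < ‖y - w‖ := by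
    rw [← dist_eq_norm]; exact hpos.trans_le (infDist_le_dist_of_mem hw)
  rw [hzw, dist_eq_norm]
  have hn : ‖‖y - w‖⁻¹ • (y - w)‖ = 1 := by
    rw [norm_smul, norm_inv, norm_norm, inv_mul_cancel₀ hyw.ne']
  have h2 := real_inner_le_norm (y + h • ν - w) (‖y - w‖⁻¹ • (y - w))
  have h3 : inner ℝ (y + h • ν - w) (‖y - w‖⁻¹ • (y - w))
      = ‖y - w‖ + h * inner ℝ ν (‖y - w‖⁻¹ • (y - w)) := by
    rw [show y + h • ν - w = (y - w) + h • ν by abel, inner_add_left, real_inner_smul_left,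
      real_inner_smul_right, real_inner_self_eq_norm_sq]
    field_simp
  rw [hn, mul_one, h3] at h2
  have h4 : infDist y S ≤ ‖y - w‖ := by
    rw [← dist_eq_norm]; exact infDist_le_dist_of_mem hw
  nlinarith

/-- If every point near `x` has a unique nearest point on the compact set `S`, then the segment
from the point `p` nearest to `x` can be extended beyond `x` with `p` remaining nearest. -/
lemma infDist_extend [ProperSpace F] {S : Set F} (hS : IsCompact S) {x p n : F} {s ε : ℝ}
    (hp : p ∈ S) (hn : ‖n‖ = 1) (hx : x = p + s • n) (hs : infDist x S = s) (hε : 0 < ε)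
    (hεs : ε < s)
    (huniq : ∀ y ∈ closedBall x ε, ∀ a ∈ S, ∀ b ∈ S, dist y a = infDist y S →
      dist y b = infDist y S → a = b) :
    infDist (x + ε • n) S = s + ε := by
  have hcontd : Continuous fun y => infDist y S := continuous_infDist_pt S
  have hcpt : IsCompact (closedBall x ε) := isCompact_closedBall x ε
  have hne : (closedBall x ε).Nonempty := ⟨x, mem_closedBall_self hε.le⟩
  obtain ⟨y, hy, hmax⟩ := hcpt.exists_isMaxOn hne (f := fun y => infDist y S) hcontd.continuousOn
  -- Maximize the distance to `S` penalized by c times the distance to `x`. An interior maximizer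
  -- could still be improved, as the distance to `S` grows at a rate above c; so the maximizer lies
  -- on the sphere.
  have key : ∀ c : ℝ, 0 < c → c < 1 → s + c * ε ≤ infDist y S := by
    intro c hc0 hc1
    obtain ⟨z, hz, hzmax⟩ := hcpt.exists_isMaxOn hne
      (f := fun y => infDist y S - c * dist y x) (by fun_prop)
    have hzx := hzmax (mem_closedBall_self hε.le)
    simp only [dist_self, mul_zero, sub_zero, hs, Set.mem_ofPred_eq] at hzx
    rcases (mem_closedBall.1 hz).lt_or_eq with hlt | heq
    · exfalso
      obtain ⟨a, ha, hza⟩ := hS.exists_infDist_eq_dist ⟨p, hp⟩ z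
      have hzpos : 0 < infDist z S := by nlinarith [dist_nonneg (x := z) (y := x)]
      obtain ⟨η, hη, hη'⟩ := exists_forall_infDist_add_smul_ge hS ha hza.symm hzpos
        (fun w hw hzw => huniq z hz w hw a ha hzw hza.symm) (c := (c + 1) / 2) (by linarith)
      set h := min (η / 2) (ε - dist z x) with hh
      have h0 : 0 < h := lt_min (by linarith) (by linarith)
      have h1 : h < η := (min_le_left _ _).trans_lt (by linarith)
      have hg := hη' h h0 h1
      set ν := (dist z a)⁻¹ • (z - a) with hν
      have hd : 0 < ‖z - a‖ := by rw [← dist_eq_norm, ← hza]; exact hzpos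
      have hν1 : ‖ν‖ = 1 := by
        rw [hν, norm_smul, dist_eq_norm, norm_inv, norm_norm, inv_mul_cancel₀ hd.ne']
      have hdist : dist (z + h • ν) x ≤ dist z x + h := by
        refine (dist_triangle _ z _).trans ?_
        rw [dist_eq_norm, add_sub_cancel_left, norm_smul, hν1, Real.norm_of_nonneg h0.le]
        linarith
      have hmem : z + h • ν ∈ closedBall x ε := by
        rw [mem_closedBall]
        linarith [min_le_right (η / 2) (ε - dist z x)]
      have := hzmax hmem
      simp only [Set.mem_ofPred_eq] at this
      nlinarith
    · have := hmax hz
      simp only [Set.mem_ofPred_eq] at this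
      rw [heq] at hzx
      linarith
  have hyge : s + ε ≤ infDist y S := by
    refine le_of_forall_pos_le_add fun δ hδ => ?_
    have h1 := key (max (1 / 2) (1 - δ / ε)) (lt_max_of_lt_left (by norm_num))
      (max_lt (by norm_num) (by have := div_pos hδ hε; linarith))
    have h2 : (1 - δ / ε) * ε ≤ max (1 / 2) (1 - δ / ε) * ε :=
      mul_le_mul_of_nonneg_right (le_max_right _ _) hε.le
    have h3 : (1 - δ / ε) * ε = ε - δ := by field_simp
    linarith
  have hyp : s + ε ≤ ‖y - p‖ := by
    rw [← dist_eq_norm]; exact hyge.trans (infDist_le_dist_of_mem hp)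
  have hyx : ‖y - x‖ ≤ ε := by rw [← dist_eq_norm]; exact hy
  -- Equality case of the triangle inequality: ‖y - p‖ ≥ s + ε, while ‖x - p‖ = s and ‖y - x‖ ≤ ε.
  have hyeq : y = x + ε • n := by
    have e1 : ‖y - p‖ ^ 2 = ‖y - x‖ ^ 2 + 2 * (s * inner ℝ (y - x) n) + s ^ 2 := by
      rw [show y - p = (y - x) + s • n by rw [hx]; abel, norm_add_sq_real, real_inner_smul_right,
        norm_smul, hn, mul_one, Real.norm_eq_abs, sq_abs]
    have e2 : ‖y - x - ε • n‖ ^ 2 = ‖y - x‖ ^ 2 - 2 * (ε * inner ℝ (y - x) n) + ε ^ 2 := by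
      rw [norm_sub_sq_real, real_inner_smul_right, norm_smul, hn, mul_one, Real.norm_eq_abs, sq_abs]
    have e3 : (s + ε) ^ 2 ≤ ‖y - p‖ ^ 2 := by
      have : 0 ≤ s + ε := by linarith
      gcongr
    have e4 : ‖y - x‖ ^ 2 ≤ ε ^ 2 := by gcongr
    have e5 : ε ≤ inner ℝ (y - x) n := by nlinarith
    have e6 : ‖y - x - ε • n‖ ^ 2 ≤ 0 := by nlinarith
    have e7 : y - x - ε • n = 0 := by
      rw [← norm_eq_zero]; exact pow_eq_zero_iff two_ne_zero |>.1 (le_antisymm e6 (sq_nonneg _))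
    rw [sub_sub, sub_eq_zero] at e7
    exact e7
  rw [← hyeq]
  refine le_antisymm ?_ hyge
  refine (infDist_le_dist_of_mem hp).trans ?_
  rw [hyeq, hx, dist_eq_norm, show p + s • n + ε • n - p = (s + ε) • n by module, norm_smul, hn,
    mul_one, Real.norm_of_nonneg (by linarith)]

lemma infDist_add_smul_of_le {S : Set F} {p n : F} (hp : p ∈ S) (hn : ‖n‖ = 1) {s r : ℝ}
    (hr : 0 ≤ r) (hrs : r ≤ s) (hs : infDist (p + s • n) S = s) : infDist (p + r • n) S = r := by
  apply le_antisymm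
  · refine (infDist_le_dist_of_mem hp).trans ?_
    simp [dist_eq_norm, norm_smul, hn, abs_of_nonneg hr]
  · have h := infDist_le_infDist_add_dist (s := S) (x := p + s • n) (y := p + r • n)
    rw [hs, dist_eq_norm, show p + s • n - (p + r • n) = (s - r) • n by module, norm_smul, hn,
      mul_one, Real.norm_of_nonneg (by linarith)] at h
    linarith

/-- A ball tangent to `S` at `p` that is free of points of `S` can be enlarged until its centre
meets the medial axis. -/
lemma infDist_add_smul_eq [ProperSpace F] {S : Set F} (hS : IsCompact S) {p n : F} (hp : p ∈ S)
    (hn : ‖n‖ = 1) {L s₀ s : ℝ} (hL : ∀ y ∈ medialAxis S, L ≤ dist p y) (hs₀ : 0 < s₀)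
    (h₀ : infDist (p + s₀ • n) S = s₀) (hs : 0 ≤ s) (hsL : s < L) :
    infDist (p + s • n) S = s := by
  -- Continuous induction on the radius: `s₀` starts it at 0, and `infDist_extend` prolongs it at
  -- any centre off the medial axis.
  have hsub := IsClosed.Icc_subset_of_forall_exists_gt (a := 0) (b := s)
    (s := {r | infDist (p + r • n) S = r}) ?_ ?_ ?_
  · exact hsub ⟨hs, le_rfl⟩
  · refine IsClosed.inter (isClosed_eq ?_ continuous_id) isClosed_Icc
    exact (continuous_infDist_pt S).comp (by fun_prop)
  · simp [infDist_zero_of_mem hp]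
  · rintro r ⟨hr, hr0, hrs⟩ y hy
    rw [Set.mem_Ioi] at hy
    rw [Set.mem_ofPred_eq] at hr
    rcases hr0.eq_or_lt with rfl | hr0
    · refine ⟨min s₀ y, ?_, lt_min hs₀ hy, min_le_right _ _⟩
      exact infDist_add_smul_of_le hp hn (le_min hs₀.le hy.le) (min_le_left _ _) h₀
    · have hxm : p + r • n ∉ medialAxis S := fun h => by
        have := hL _ h
        simp [dist_eq_norm, norm_smul, hn, abs_of_pos hr0] at this
        linarith
      obtain ⟨ε, hε, hball⟩ := Metric.isOpen_iff.1 (isClosed_closure (s := _)).isOpen_compl _ hxm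
      set e := min (ε / 2) (r / 2) with he
      have he0 : 0 < e := lt_min (by linarith) (by linarith)
      have hext := infDist_extend hS hp hn rfl hr he0
        ((min_le_right _ _).trans_lt (by linarith)) (fun w hw a ha b hb hwa hwb => by
          by_contra hab
          have hw' : w ∈ ball (p + r • n) ε :=
            closedBall_subset_ball ((min_le_left _ _).trans_lt (by linarith)) hw
          exact hball hw' (subset_closure ⟨a, ha, b, hb, hab, hwa, hwb⟩))
      rw [show p + r • n + e • n = p + (r + e) • n by module] at hext
      refine ⟨min (r + e) y, ?_, lt_min (by linarith) hy, min_le_right _ _⟩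
      exact infDist_add_smul_of_le hp hn (le_min (by linarith) (hr0.le.trans hy.le))
        (min_le_left _ _) hext

lemma infDist_add_smul_eq_iff {S : Set F} {p n : F} (hp : p ∈ S) (hn : ‖n‖ = 1) {s : ℝ}
    (hs : 0 ≤ s) :
    infDist (p + s • n) S = s ↔ ∀ z ∈ S, 2 * s * inner ℝ (z - p) n ≤ ‖z - p‖ ^ 2 := by
  have hsq : ∀ z, dist (p + s • n) z ^ 2 = s ^ 2 + (‖z - p‖ ^ 2 - 2 * s * inner ℝ (z - p) n) := by
    intro z
    rw [dist_comm, dist_eq_norm, show z - (p + s • n) = (z - p) - s • n by abel, norm_sub_sq_real,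
      real_inner_smul_right, norm_smul, hn, mul_one, Real.norm_eq_abs, sq_abs]
    ring
  constructor
  · intro h z hz
    have h1 : s ≤ dist (p + s • n) z := by
      conv_lhs => rw [← h]
      exact infDist_le_dist_of_mem hz
    have h2 : s ^ 2 ≤ dist (p + s • n) z ^ 2 := by gcongr
    rw [hsq] at h2
    linarith
  · intro h
    apply le_antisymm
    · refine (infDist_le_dist_of_mem hp).trans ?_
      simp [dist_eq_norm, norm_smul, hn, abs_of_nonneg hs]
    · rw [le_infDist ⟨p, hp⟩]
      intro z hz
      refine abs_le_of_sq_le_sq' ?_ dist_nonneg |>.2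
      rw [hsq]
      linarith [h z hz]

/-- Federer's inequality for a point at distance at least `L` from the medial axis. -/
lemma two_mul_inner_le [ProperSpace F] {S : Set F} (hS : IsCompact S) {p n : F} (hp : p ∈ S)
    (hn : ‖n‖ = 1) {L s₀ : ℝ} (hL₀ : 0 ≤ L) (hL : ∀ y ∈ medialAxis S, L ≤ dist p y) (hs₀ : 0 < s₀)
    (h₀ : ∀ z ∈ S, 2 * s₀ * inner ℝ (z - p) n ≤ ‖z - p‖ ^ 2) {z : F} (hz : z ∈ S) :
    2 * L * inner ℝ (z - p) n ≤ ‖z - p‖ ^ 2 := by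
  have h₀' := (infDist_add_smul_eq_iff hp hn hs₀.le).2 h₀
  rcases le_or_gt (inner ℝ (z - p) n) 0 with hneg | hpos
  · nlinarith [sq_nonneg ‖z - p‖]
  · by_contra! hlt
    have : ‖z - p‖ ^ 2 / (2 * inner ℝ (z - p) n) < L := by
      rw [div_lt_iff₀ (by linarith)]; linarith
    obtain ⟨s, hs1, hs2⟩ := exists_between this
    have hs : 0 ≤ s := le_trans (by positivity) hs1.le
    have := (infDist_add_smul_eq_iff hp hn hs).1
      (infDist_add_smul_eq hS hp hn hL hs₀ h₀' hs hs2) z hz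
    rw [div_lt_iff₀ (by linarith)] at hs1
    linarith

end EmptyBall
-- Normal components of vectors
section Projection

variable {F : Type*} [NormedAddCommGroup F] [InnerProductSpace ℝ F]

lemma starProjection_orthogonal_eq_zero (V : Submodule ℝ F) [V.HasOrthogonalProjection] {w : F}
    (hw : w ∈ V) : Vᗮ.starProjection w = 0 := by
  rw [Submodule.starProjection_apply_eq_zero_iff]
  exact Submodule.le_orthogonal_orthogonal V hw

lemma norm_starProjection_orthogonal_le_norm_sub (V : Submodule ℝ F) [V.HasOrthogonalProjection]
    {u w : F} (hw : w ∈ V) : ‖Vᗮ.starProjection u‖ ≤ ‖u - w‖ := by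
  have h : Vᗮ.starProjection u = Vᗮ.starProjection (u - w) := by
    rw [map_sub, starProjection_orthogonal_eq_zero V hw, sub_zero]
  rw [h]
  exact Submodule.norm_starProjection_apply_le _ _

lemma norm_starProjection_orthogonal_le {V : Submodule ℝ F} [V.HasOrthogonalProjection] {w : F}
    {r : ℝ} (hr : 0 ≤ r) (h : ∀ n ∈ Vᗮ, ‖n‖ = 1 → inner ℝ w n ≤ r) :
    ‖Vᗮ.starProjection w‖ ≤ r := by
  set y := Vᗮ.starProjection w with hy
  rcases eq_or_ne y 0 with h0 | h0
  · simpa [h0] using hr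
  · have hpos : 0 < ‖y‖ := norm_pos_iff.2 h0
    have hmem : y ∈ Vᗮ := Submodule.starProjection_apply_mem _ _
    have h1 := h (‖y‖⁻¹ • y) (Submodule.smul_mem _ _ hmem)
      (by rw [norm_smul, norm_inv, norm_norm, inv_mul_cancel₀ hpos.ne'])
    have h2 : inner ℝ w y = ‖y‖ ^ 2 := by
      have h3 : inner ℝ (w - y) y = 0 := by
        have := Submodule.sub_starProjection_mem_orthogonal (K := Vᗮ) w
        exact Submodule.inner_left_of_mem_orthogonal hmem this
      rw [inner_sub_left, real_inner_self_eq_norm_sq] at h3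
      linarith
    rw [real_inner_smul_right, h2] at h1
    calc ‖y‖ = ‖y‖⁻¹ * ‖y‖ ^ 2 := by field_simp
      _ ≤ r := h1

end Projection

/-! ### Second-order geometry of an immersion -/

section Calculus

variable {E F : Type*} [NormedAddCommGroup E] [NormedSpace ℝ E]
  [NormedAddCommGroup F] [InnerProductSpace ℝ F]

lemma hasDerivAt_add_smul (a b : E) (h : ℝ) : HasDerivAt (fun h : ℝ => a + h • b) b h := by
  simpa using ((hasDerivAt_id h).smul_const b).const_add a

lemma hasDerivAt_comp_add_smul {G : Type*} [NormedAddCommGroup G] [NormedSpace ℝ G] {ψ : E → G}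
    {a b : E} {h : ℝ} (hψ : DifferentiableAt ℝ ψ (a + h • b)) :
    HasDerivAt (fun h : ℝ => ψ (a + h • b)) (fderiv ℝ ψ (a + h • b) b) h :=
  hψ.hasFDerivAt.comp_hasDerivAt h (hasDerivAt_add_smul a b h)

lemma hasDerivAt_comp_add_smul_zero {G : Type*} [NormedAddCommGroup G] [NormedSpace ℝ G]
    {ψ : E → G} {a : E} (b : E) (hψ : DifferentiableAt ℝ ψ a) :
    HasDerivAt (fun h : ℝ => ψ (a + h • b)) (fderiv ℝ ψ a b) 0 := by
  have h := hasDerivAt_comp_add_smul (a := a) (b := b) (h := 0) (ψ := ψ) (by simpa using hψ)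
  rwa [zero_smul, add_zero] at h

lemma exists_pos_mul_norm_le [FiniteDimensional ℝ E] {A : E →L[ℝ] F} (hA : Function.Injective A) :
    ∃ c > 0, ∀ b, c * ‖b‖ ≤ ‖A b‖ := by
  obtain ⟨K, hK, hAK⟩ := A.toLinearMap.exists_antilipschitzWith (LinearMap.ker_eq_bot.2 hA)
  refine ⟨(K : ℝ)⁻¹, by positivity, fun b => ?_⟩
  have h := hAK.le_mul_dist b 0
  simp only [dist_zero_right, map_zero, ContinuousLinearMap.coe_coe] at h
  rw [inv_mul_le_iff₀ (by exact_mod_cast hK)]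
  exact h

lemma exists_norm_sub_sub_le {φ : E → F} {a₀ : E} (hφ : ContDiffAt ℝ 2 φ a₀) :
    ∃ K > 0, ∀ᶠ a in 𝓝 a₀, ‖φ a - φ a₀ - fderiv ℝ φ a₀ (a - a₀)‖ ≤ K * ‖a - a₀‖ ^ 2 := by
  have h1 : ContDiffAt ℝ 1 (fderiv ℝ φ) a₀ := hφ.fderiv_right (by norm_num [one_add_one_eq_two])
  obtain ⟨K, t, ht, hK⟩ := h1.exists_lipschitzOnWith
  have hdiff : ∀ᶠ a in 𝓝 a₀, DifferentiableAt ℝ φ a := by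
    filter_upwards [hφ.eventually (by simp)] with a ha using ha.differentiableAt (by simp)
  obtain ⟨r, hr, hball⟩ := Metric.mem_nhds_iff.1 (Filter.inter_mem ht hdiff)
  refine ⟨K + 1, by positivity, ?_⟩
  filter_upwards [Metric.ball_mem_nhds a₀ hr] with a ha
  have hseg : ∀ x ∈ segment ℝ a₀ a, x ∈ Metric.ball a₀ r := fun x hx =>
    (convex_ball a₀ r).segment_subset (Metric.mem_ball_self hr) ha hx
  have := (convex_segment a₀ a).norm_image_sub_le_of_norm_fderiv_le' (𝕜 := ℝ) (f := φ)
    (φ := fderiv ℝ φ a₀) (C := (K : ℝ) * ‖a - a₀‖) (fun x hx => (hball (hseg x hx)).2)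
    (fun x hx => ?_) (left_mem_segment ℝ a₀ a) (right_mem_segment ℝ a₀ a)
  · nlinarith [sq_nonneg ‖a - a₀‖]
  · have h2 := hK.dist_le_mul x (hball (hseg x hx)).1 a₀ (hball (Metric.mem_ball_self hr)).1
    rw [dist_eq_norm, dist_eq_norm] at h2
    refine h2.trans (mul_le_mul_of_nonneg_left ?_ K.2)
    rw [segment_eq_image'] at hx
    obtain ⟨θ, hθ, rfl⟩ := hx
    rw [add_sub_cancel_left, norm_smul, Real.norm_of_nonneg hθ.1]
    exact mul_le_of_le_one_left (norm_nonneg _) hθ.2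

/-- The image of an immersion touches its normal directions at most quadratically. -/
lemma exists_two_mul_inner_le [FiniteDimensional ℝ E] {φ : E → F} {a₀ : E}
    (hφ : ContDiffAt ℝ 2 φ a₀) (hA : Function.Injective (fderiv ℝ φ a₀)) :
    ∃ s > 0, ∀ᶠ a in 𝓝 a₀, ∀ n ∈ (fderiv ℝ φ a₀).rangeᗮ, ‖n‖ = 1 →
      2 * s * inner ℝ (φ a - φ a₀) n ≤ ‖φ a - φ a₀‖ ^ 2 := by
  obtain ⟨c, hc, hcA⟩ := exists_pos_mul_norm_le hA
  obtain ⟨K, hK, hKφ⟩ := exists_norm_sub_sub_le hφ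
  -- Within distance c/(2K) of `a₀`, the remainder K d² is at most c d/2, so the image moves by at
  -- least c d/2 while its normal part is at most K d². The constant makes 2s·K d² = (c d/2)².
  refine ⟨c ^ 2 / (8 * K), by positivity, ?_⟩
  filter_upwards [hKφ, Metric.ball_mem_nhds a₀ (show 0 < c / (2 * K) by positivity)] with a ha hab
    n hn hn1
  set d := ‖a - a₀‖ with hd
  have hd0 : 0 ≤ d := norm_nonneg _
  have hdc : d * (2 * K) ≤ c := by
    rw [Metric.mem_ball, dist_eq_norm, lt_div_iff₀ (by positivity)] at hab
    exact hab.le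
  have h1 : c / 2 * d ≤ ‖φ a - φ a₀‖ := by
    have h2 := hcA (a - a₀)
    have h3 : ‖fderiv ℝ φ a₀ (a - a₀)‖ ≤
        ‖φ a - φ a₀‖ + ‖φ a - φ a₀ - fderiv ℝ φ a₀ (a - a₀)‖ := by
      have := norm_sub_le (φ a - φ a₀) (φ a - φ a₀ - fderiv ℝ φ a₀ (a - a₀))
      rwa [sub_sub_cancel] at this
    nlinarith
  have h4 : inner ℝ (φ a - φ a₀) n ≤ K * d ^ 2 := by
    have h5 : inner ℝ (fderiv ℝ φ a₀ (a - a₀)) n = 0 :=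
      Submodule.inner_right_of_mem_orthogonal (LinearMap.mem_range_self _ (a - a₀)) hn
    have h6 := real_inner_le_norm (φ a - φ a₀ - fderiv ℝ φ a₀ (a - a₀)) n
    rw [inner_sub_left, h5, sub_zero, hn1, mul_one] at h6
    exact h6.trans ha
  calc 2 * (c ^ 2 / (8 * K)) * inner ℝ (φ a - φ a₀) n
      ≤ 2 * (c ^ 2 / (8 * K)) * (K * d ^ 2) := by gcongr
    _ = (c / 2 * d) ^ 2 := by field_simp; norm_num
    _ ≤ ‖φ a - φ a₀‖ ^ 2 := by gcongr

/-- The second fundamental form is bounded by the curvature of a ball touching from outside. -/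
lemma mul_inner_fderiv_fderiv_le {φ : E → F} {a₀ : E} (hφ : ContDiffAt ℝ 2 φ a₀) {L : ℝ} {n : F}
    (hn : n ∈ (fderiv ℝ φ a₀).rangeᗮ)
    (hL : ∀ᶠ a in 𝓝 a₀, 2 * L * inner ℝ (φ a - φ a₀) n ≤ ‖φ a - φ a₀‖ ^ 2) (b : E) :
    L * inner ℝ (fderiv ℝ (fderiv ℝ φ) a₀ b b) n ≤ ‖fderiv ℝ φ a₀ b‖ ^ 2 := by
  have h1 : ContDiffAt ℝ 1 (fderiv ℝ φ) a₀ := hφ.fderiv_right (by norm_num [one_add_one_eq_two])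
  have hdiff : ∀ᶠ a in 𝓝 a₀, DifferentiableAt ℝ φ a := by
    filter_upwards [hφ.eventually (by simp)] with a ha using ha.differentiableAt (by simp)
  have hl0 : Filter.Tendsto (fun h : ℝ => a₀ + h • b) (𝓝 0) (𝓝 a₀) := by
    have := (hasDerivAt_add_smul a₀ b 0).continuousAt.tendsto
    rwa [zero_smul, add_zero] at this
  set k : ℝ → ℝ := fun h => 2 * L * inner ℝ (φ (a₀ + h • b) - φ a₀) n
    - ‖φ (a₀ + h • b) - φ a₀‖ ^ 2 with hk
  have hk' : ∀ᶠ h in 𝓝 (0 : ℝ), HasDerivAt k (2 * L * inner ℝ (fderiv ℝ φ (a₀ + h • b) b) n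
      - 2 * inner ℝ (φ (a₀ + h • b) - φ a₀) (fderiv ℝ φ (a₀ + h • b) b)) h := by
    filter_upwards [hl0.eventually hdiff] with h hh
    have h2 : HasDerivAt (fun h : ℝ => φ (a₀ + h • b) - φ a₀) (fderiv ℝ φ (a₀ + h • b) b) h :=
      (hasDerivAt_comp_add_smul hh).sub_const _
    have h3 := (h2.inner ℝ (hasDerivAt_const h n)).const_mul (2 * L)
    simp only [inner_zero_right, zero_add] at h3
    exact h3.sub h2.norm_sq
  have hder : deriv k =ᶠ[𝓝 0] fun h => 2 * L * inner ℝ (fderiv ℝ φ (a₀ + h • b) b) n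
      - 2 * inner ℝ (φ (a₀ + h • b) - φ a₀) (fderiv ℝ φ (a₀ + h • b) b) := by
    filter_upwards [hk'] with h hh using hh.deriv
  have hperp : inner ℝ (fderiv ℝ φ a₀ b) n = 0 := 
    Submodule.inner_right_of_mem_orthogonal (LinearMap.mem_range_self _ b) hn
  have hder2 : HasDerivAt (deriv k) (2 * L * inner ℝ (fderiv ℝ (fderiv ℝ φ) a₀ b b) n
      - 2 * ‖fderiv ℝ φ a₀ b‖ ^ 2) 0 := by
    refine HasDerivAt.congr_of_eventuallyEq ?_ hder
    have h2 : HasDerivAt (fun h : ℝ => φ (a₀ + h • b) - φ a₀) (fderiv ℝ φ a₀ b) 0 :=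
      (hasDerivAt_comp_add_smul_zero b hdiff.self_of_nhds).sub_const _
    have h3 : HasDerivAt (fun h : ℝ => fderiv ℝ φ (a₀ + h • b) b)
        (fderiv ℝ (fderiv ℝ φ) a₀ b b) 0 := by
      have := (hasDerivAt_comp_add_smul_zero b (h1.differentiableAt (by simp))).clm_apply
        (hasDerivAt_const 0 b)
      simpa using this
    have h4 := ((h3.inner ℝ (hasDerivAt_const 0 n)).const_mul (2 * L)).sub
      ((h2.inner ℝ h3).const_mul 2)
    refine HasDerivAt.congr_deriv h4 ?_
    simp
  -- Otherwise k''(0) > 0 and 0 is a local minimum of `k`; since also k ≤ 0 = k(0), `k` vanishes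
  -- near 0, contradicting k''(0) > 0.
  by_contra! hlt
  have hpos : 0 < deriv (deriv k) 0 := by rw [hder2.deriv]; linarith
  have hk0 : k 0 = 0 := by simp [hk]
  have hk0' : deriv k 0 = 0 := by
    rw [hder.self_of_nhds]; simp [hperp]
  have hmin := isLocalMin_of_deriv_deriv_pos hpos hk0' hk'.self_of_nhds.continuousAt
  have hmax : ∀ᶠ h in 𝓝 (0 : ℝ), k h ≤ 0 := by
    filter_upwards [hl0.eventually hL] with h hh
    simp only [hk]; linarith
  have hzero : k =ᶠ[𝓝 0] fun _ => (0 : ℝ) := by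
    filter_upwards [hmin, hmax] with h h2 h3
    exact le_antisymm h3 (hk0 ▸ h2)
  have := hzero.deriv.deriv_eq
  simp at this
  linarith

lemma mul_norm_starProjection_fderiv_fderiv_le [FiniteDimensional ℝ E] [FiniteDimensional ℝ F]
    {φ : E → F} {a₀ : E}
    (hφ : ContDiffAt ℝ 2 φ a₀) (hA : Function.Injective (fderiv ℝ φ a₀)) {L : ℝ} (hL₀ : 0 < L)
    (hL : ∀ᶠ a in 𝓝 a₀, ∀ n ∈ (fderiv ℝ φ a₀).rangeᗮ, ‖n‖ = 1 →
      2 * L * inner ℝ (φ a - φ a₀) n ≤ ‖φ a - φ a₀‖ ^ 2) (v b : E) :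
    ‖((fderiv ℝ φ a₀).rangeᗮ).starProjection (fderiv ℝ (fderiv ℝ φ) a₀ v b)‖ ≤
      ‖fderiv ℝ φ a₀ v‖ * ‖fderiv ℝ φ a₀ b‖ / L := by
  set A := fderiv ℝ φ a₀ with hAdef
  set B := fderiv ℝ (fderiv ℝ φ) a₀ with hB
  have hsymm : ∀ v b, B v b = B b v := by
    have := hφ.isSymmSndFDerivAt (by simp)
    exact fun v b => this.eq v b
  refine norm_starProjection_orthogonal_le (by positivity) fun n hn hn1 => ?_
  rw [le_div_iff₀ hL₀]
  have hquad : ∀ n ∈ A.rangeᗮ, ‖n‖ = 1 → ∀ b, L * inner ℝ (B b b) n ≤ ‖A b‖ ^ 2 :=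
    fun n hn hn1 => mul_inner_fderiv_fderiv_le hφ hn (hL.mono fun a ha => ha n hn hn1)
  rcases eq_or_ne v 0 with rfl | hv
  · simp
  rcases eq_or_ne b 0 with rfl | hb
  · simp
  have hAv : 0 < ‖A v‖ := norm_pos_iff.2 fun h => hv (hA (by rw [h, map_zero]))
  have hAb : 0 < ‖A b‖ := norm_pos_iff.2 fun h => hb (hA (by rw [h, map_zero]))
  -- Polarization: the weights give both summands the same length under `A`, and using `-n` for the
  -- difference turns the one-sided quadratic bound into a bilinear one.
  have h1 := hquad n hn hn1 (‖A b‖ • v + ‖A v‖ • b)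
  have h2 := hquad (-n) (neg_mem hn) (by rwa [norm_neg]) (‖A b‖ • v - ‖A v‖ • b)
  have h3 : ‖A (‖A b‖ • v + ‖A v‖ • b)‖ ^ 2 + ‖A (‖A b‖ • v - ‖A v‖ • b)‖ ^ 2
      = 4 * ‖A v‖ ^ 2 * ‖A b‖ ^ 2 := by
    simp only [map_add, map_sub, map_smul]
    have := parallelogram_law_with_norm ℝ (‖A b‖ • A v) (‖A v‖ • A b)
    simp only [norm_smul, norm_norm] at this
    nlinarith
  have h4 : inner ℝ (B (‖A b‖ • v + ‖A v‖ • b) (‖A b‖ • v + ‖A v‖ • b)) n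
      + inner ℝ (B (‖A b‖ • v - ‖A v‖ • b) (‖A b‖ • v - ‖A v‖ • b)) (-n)
      = 4 * ‖A b‖ * ‖A v‖ * inner ℝ (B v b) n := by
    simp only [map_add, map_sub, map_smul, add_apply,
      sub_apply, smul_apply, inner_neg_right,
      inner_add_left, inner_sub_left, real_inner_smul_left, hsymm b v, smul_add, smul_sub]
    ring
  have h5 : 4 * (‖A b‖ * ‖A v‖) * (inner ℝ (B v b) n * L) ≤
      4 * (‖A b‖ * ‖A v‖) * (‖A v‖ * ‖A b‖) := by
    calc _ = L * (4 * ‖A b‖ * ‖A v‖ * inner ℝ (B v b) n) := by ring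
      _ ≤ 4 * ‖A v‖ ^ 2 * ‖A b‖ ^ 2 := by rw [← h4, ← h3]; linarith
      _ = _ := by ring
  exact le_of_mul_le_mul_left h5 (by positivity)

/-- The tangent spaces of an immersed submanifold turn with speed at most `1 / L`. -/
lemma eventually_norm_starProjection_le [FiniteDimensional ℝ E] [FiniteDimensional ℝ F]
    {φ : E → F} {a₀ : E}
    (hφ : ContDiffAt ℝ 2 φ a₀) (hA : Function.Injective (fderiv ℝ φ a₀)) {L K : ℝ} (hL₀ : 0 < L)
    (hL : ∀ᶠ a in 𝓝 a₀, ∀ n ∈ (fderiv ℝ φ a₀).rangeᗮ, ‖n‖ = 1 →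
      2 * L * inner ℝ (φ a - φ a₀) n ≤ ‖φ a - φ a₀‖ ^ 2) (hK : 1 / L < K) {v : E} (hv : v ≠ 0) :
    ∀ᶠ h in 𝓝[>] (0 : ℝ), ∀ w ∈ (fderiv ℝ φ (a₀ + h • v)).range,
      ‖((fderiv ℝ φ a₀).rangeᗮ).starProjection w‖ ≤ h * (K * ‖fderiv ℝ φ a₀ v‖) * ‖w‖ := by
  obtain ⟨c, hc, hcA⟩ := exists_pos_mul_norm_le hA
  have hII := mul_norm_starProjection_fderiv_fderiv_le hφ hA hL₀ hL
  set A := fderiv ℝ φ a₀ with hAdef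
  set B := fderiv ℝ (fderiv ℝ φ) a₀ with hB
  set N := (A.rangeᗮ).starProjection with hN
  have hAv : 0 < ‖A v‖ := norm_pos_iff.2 fun h => hv (hA (by rw [h, map_zero]))
  have hKpos : 0 < K := lt_trans (by positivity) hK
  -- The gap between 1/L and K absorbs two errors: the Taylor remainder (δ/c) and the replacement of
  -- ‖A b‖ by the norm of the nearby tangent vector (factor 1 - δ).
  obtain ⟨δ, hδ0, hδ1, hδ⟩ : ∃ δ : ℝ, 0 < δ ∧ δ < 1 ∧
      ‖A v‖ / L + δ / c ≤ K * ‖A v‖ * (1 - δ) := by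
    have hc1 : ContinuousAt (fun δ : ℝ => K * ‖A v‖ * (1 - δ) - (‖A v‖ / L + δ / c)) 0 := by
      fun_prop
    have h0 : 0 < K * ‖A v‖ * (1 - 0) - (‖A v‖ / L + 0 / c) := by
      have := mul_lt_mul_of_pos_right hK hAv
      have h2 : 1 / L * ‖A v‖ = ‖A v‖ / L := by ring
      simp only [sub_zero, mul_one, zero_div, add_zero]
      linarith
    have he := (hc1.eventually (lt_mem_nhds h0)).filter_mono (nhdsWithin_le_nhds (s := Set.Ioi 0))
    obtain ⟨δ, h1, h2, h3⟩ := (he.and (Ioo_mem_nhdsGT (zero_lt_one (α := ℝ)))).exists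
    exact ⟨δ, h2, h3, by linarith⟩
  have hder : HasDerivAt (fun h : ℝ => fderiv ℝ φ (a₀ + h • v)) (B v) 0 := by
    have h1 : ContDiffAt ℝ 1 (fderiv ℝ φ) a₀ := hφ.fderiv_right (by norm_num [one_add_one_eq_two])
    exact hasDerivAt_comp_add_smul_zero v (h1.differentiableAt (by simp))
  have hR : ∀ᶠ h in 𝓝[>] (0 : ℝ), ‖fderiv ℝ φ (a₀ + h • v) - A - h • B v‖ ≤ δ * h := by
    have := (hasDerivAt_iff_isLittleO.1 hder).def hδ0
    filter_upwards [this.filter_mono nhdsWithin_le_nhds, self_mem_nhdsWithin] with h h1 h2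
    simpa [abs_of_pos (Set.mem_Ioi.1 h2)] using h1
  have hsmall : ∀ᶠ h in 𝓝[>] (0 : ℝ), h * ‖B v‖ + δ * h < δ * c := by
    have hc1 : ContinuousAt (fun h : ℝ => h * ‖B v‖ + δ * h) 0 := by fun_prop
    exact (hc1.eventually (gt_mem_nhds (by simp; positivity))).filter_mono nhdsWithin_le_nhds
  filter_upwards [hR, hsmall, self_mem_nhdsWithin] with h h1 h2 h0
  rw [Set.mem_Ioi] at h0
  rintro _ ⟨b, rfl⟩
  set R := fderiv ℝ φ (a₀ + h • v) - A - h • B v with hRdef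
  have hDb : fderiv ℝ φ (a₀ + h • v) b = A b + (h • B v b + R b) := by
    simp [hRdef]
  have hRb : ‖R b‖ ≤ δ * h * ‖b‖ := (R.le_opNorm b).trans (by gcongr)
  have hBb : ‖h • B v b‖ ≤ h * ‖B v‖ * ‖b‖ := by
    rw [norm_smul, Real.norm_of_nonneg h0.le, mul_assoc]
    gcongr
    exact (B v).le_opNorm b
  have hb := hcA b
  have hw : ‖A b‖ * (1 - δ) ≤ ‖fderiv ℝ φ (a₀ + h • v) b‖ := by
    have h3 : ‖A b‖ ≤ ‖fderiv ℝ φ (a₀ + h • v) b‖ + (‖h • B v b‖ + ‖R b‖) := by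
      have := norm_sub_le (fderiv ℝ φ (a₀ + h • v) b) (h • B v b + R b)
      rw [hDb, add_sub_cancel_right, ← hDb] at this
      linarith [norm_add_le (h • B v b) (R b)]
    have h4 : (h * ‖B v‖ + δ * h) * ‖b‖ ≤ δ * c * ‖b‖ := by gcongr
    nlinarith
  have hNw : ‖N (fderiv ℝ φ (a₀ + h • v) b)‖ ≤ h * (‖A v‖ * ‖A b‖ / L) + δ * h * ‖b‖ := by
    have hAb : N (A b) = 0 :=
      starProjection_orthogonal_eq_zero _ (LinearMap.mem_range_self A.toLinearMap b)
    rw [hDb, map_add, hAb, zero_add, map_add, map_smul]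
    refine (norm_add_le _ _).trans (add_le_add ?_ ?_)
    · rw [norm_smul, Real.norm_of_nonneg h0.le]
      gcongr
      exact hII v b
    · exact (Submodule.norm_starProjection_apply_le _ _).trans hRb
  have hbc : ‖b‖ ≤ ‖A b‖ / c := by rw [le_div_iff₀ hc]; linarith
  change ‖N (fderiv ℝ φ (a₀ + h • v) b)‖ ≤ h * (K * ‖A v‖) * ‖fderiv ℝ φ (a₀ + h • v) b‖
  calc _ ≤ h * (‖A v‖ * ‖A b‖ / L) + δ * h * ‖b‖ := hNw
    _ ≤ h * (‖A v‖ * ‖A b‖ / L) + δ * h * (‖A b‖ / c) := by gcongr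
    _ = h * ‖A b‖ * (‖A v‖ / L + δ / c) := by ring
    _ ≤ h * ‖A b‖ * (K * ‖A v‖ * (1 - δ)) := by gcongr
    _ = h * (K * ‖A v‖) * (‖A b‖ * (1 - δ)) := by ring
    _ ≤ _ := by gcongr

/-- Upper semicontinuity: the normal part of `u` has the norm of the distance from `u` to the
tangent space, and a fixed parameter vector `b` gives a competitor varying continuously with `a`. -/
lemma eventually_norm_starProjection_lt [FiniteDimensional ℝ F] {φ : E → F} {a₀ : E}
    (hφ : ContinuousAt (fderiv ℝ φ) a₀) (u : F) {r : ℝ}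
    (hr : ‖((fderiv ℝ φ a₀).rangeᗮ).starProjection u‖ < r) :
    ∀ᶠ a in 𝓝 a₀, ‖((fderiv ℝ φ a).rangeᗮ).starProjection u‖ < r := by
  obtain ⟨b, hb⟩ : (fderiv ℝ φ a₀).range.starProjection u ∈ (fderiv ℝ φ a₀).range :=
    Submodule.starProjection_apply_mem _ _
  have hval : ‖u - fderiv ℝ φ a₀ b‖ < r := by
    have hb' : fderiv ℝ φ a₀ b = (fderiv ℝ φ a₀).range.starProjection u := hb
    rw [hb', ← Submodule.starProjection_orthogonal_val]
    exact hr
  have hc : ContinuousAt (fun a => ‖u - fderiv ℝ φ a b‖) a₀ := by fun_prop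
  filter_upwards [hc.eventually (gt_mem_nhds hval)] with a ha
  exact (norm_starProjection_orthogonal_le_norm_sub _
    (LinearMap.mem_range_self (fderiv ℝ φ a).toLinearMap b)).trans_lt ha

end Calculus

/-! ### Local parametrizations and the maximum argument -/

lemma eventually_norm_sub_le {F : Type*} [NormedAddCommGroup F] [InnerProductSpace ℝ F]
    {γ : ℝ → F} {γ' p : F} {κ : ℝ} (hγ : HasDerivAt γ γ' 0) (hp : γ 0 ≠ p)
    (hκ : inner ℝ (γ 0 - p) γ' < -κ * ‖γ 0 - p‖) :
    ∀ᶠ h in 𝓝[>] (0 : ℝ), ‖γ h - p‖ < ‖γ 0 - p‖ - κ * h := by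
  have hpos : 0 < ‖γ 0 - p‖ := norm_pos_iff.2 (sub_ne_zero.2 hp)
  have h1 := (hγ.sub_const p).norm_sq.sqrt (by positivity)
  simp only [Real.sqrt_sq (norm_nonneg _)] at h1
  have h2 : 2 * inner ℝ (γ 0 - p) γ' / (2 * ‖γ 0 - p‖) < -κ := by
    rw [div_lt_iff₀ (by positivity)]
    linarith
  have h3 := h1.hasDerivWithinAt.limsup_slope_le' (s := Set.Ioi 0) (by simp) h2
  filter_upwards [h3, self_mem_nhdsWithin] with h h4 h5
  rw [Set.mem_Ioi] at h5
  rw [slope_def_field, div_lt_iff₀ (by linarith)] at h4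
  linarith

/-- `σ` is a `C²` immersed parametrization of `ι : M → F` near `x = σ a₀`, with tangent spaces given
by `T`. -/
structure IsLocalParam {E F M : Type*} [NormedAddCommGroup E] [NormedSpace ℝ E]
    [NormedAddCommGroup F] [InnerProductSpace ℝ F] [TopologicalSpace M] (ι : M → F)
    (T : M → Submodule ℝ F) (x : M) (σ : E → M) (a₀ : E) : Prop where
  apply_eq : σ a₀ = x
  map_nhds : Filter.map σ (𝓝 a₀) = 𝓝 x
  contDiffAt : ContDiffAt ℝ 2 (ι ∘ σ) a₀
  injective : Function.Injective (fderiv ℝ (ι ∘ σ) a₀)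
  eventually_eq : ∀ᶠ a in 𝓝 a₀, T (σ a) = (fderiv ℝ (ι ∘ σ) a).range

section Submanifold

variable {E F M : Type*} [NormedAddCommGroup E] [NormedSpace ℝ E] [FiniteDimensional ℝ E]
  [NormedAddCommGroup F] [InnerProductSpace ℝ F] [TopologicalSpace M] {ι : M → F}
  {T : M → Submodule ℝ F}

lemma IsLocalParam.exists_forall_two_mul_inner_le {x : M} {σ : E → M} {a₀ : E}
    (h : IsLocalParam ι T x σ a₀) (hι : IsEmbedding ι) :
    ∃ s > 0, ∀ n ∈ (T x)ᗮ, ‖n‖ = 1 → ∀ z ∈ Set.range ι,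
      2 * s * inner ℝ (z - ι x) n ≤ ‖z - ι x‖ ^ 2 := by
  obtain ⟨s, hs, hev⟩ := exists_two_mul_inner_le h.contDiffAt h.injective
  rw [← h.eventually_eq.self_of_nhds, h.apply_eq] at hev
  simp only [Function.comp_apply, h.apply_eq] at hev
  have hev' : ∀ᶠ y in 𝓝 x, ∀ n ∈ (T x)ᗮ, ‖n‖ = 1 →
      2 * s * inner ℝ (ι y - ι x) n ≤ ‖ι y - ι x‖ ^ 2 := by
    rw [← h.map_nhds, Filter.eventually_map]
    exact hev
  rw [hι.nhds_eq_comap, Filter.eventually_comap] at hev'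
  obtain ⟨δ, hδ, hδ'⟩ := Metric.eventually_nhds_iff.1 hev'
  -- Beyond distance δ, Cauchy–Schwarz suffices with δ/2; the embedding ensures that points of the
  -- image within δ are covered by the local estimate.
  refine ⟨min s (δ / 2), lt_min hs (by linarith), ?_⟩
  rintro n hn hn1 _ ⟨y, rfl⟩
  have hle := real_inner_le_norm (ι y - ι x) n
  rw [hn1, mul_one] at hle
  have hm := min_le_left s (δ / 2)
  have hm' := min_le_right s (δ / 2)
  have hm0 : 0 < min s (δ / 2) := lt_min hs (by linarith)
  rcases le_or_gt (inner ℝ (ι y - ι x) n) 0 with h0 | h0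
  · nlinarith [sq_nonneg ‖ι y - ι x‖]
  rcases lt_or_ge (dist (ι y) (ι x)) δ with hd | hd
  · exact (by gcongr : _ ≤ 2 * s * inner ℝ (ι y - ι x) n).trans (hδ' hd y rfl n hn hn1)
  · rw [dist_eq_norm] at hd
    calc _ ≤ 2 * (δ / 2) * ‖ι y - ι x‖ := by gcongr
      _ = δ * ‖ι y - ι x‖ := by ring
      _ ≤ ‖ι y - ι x‖ * ‖ι y - ι x‖ := by gcongr
      _ = _ := by ring

lemma IsLocalParam.two_mul_inner_le [ProperSpace F] [CompactSpace M] {x : M} {σ : E → M} {a₀ : E}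
    (h : IsLocalParam ι T x σ a₀) (hι : IsEmbedding ι) {L : ℝ} (hL₀ : 0 ≤ L)
    (hL : ∀ y ∈ medialAxis (Set.range ι), L ≤ dist (ι x) y) {n : F} (hn : n ∈ (T x)ᗮ)
    (hn1 : ‖n‖ = 1) (y : M) : 2 * L * inner ℝ (ι y - ι x) n ≤ ‖ι y - ι x‖ ^ 2 := by
  obtain ⟨s, hs, hs'⟩ := h.exists_forall_two_mul_inner_le hι
  exact TangentVariation.two_mul_inner_le (isCompact_range hι.continuous) (Set.mem_range_self x)
    hn1 hL₀ hL hs (hs' n hn hn1) (Set.mem_range_self y)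

variable [FiniteDimensional ℝ F]

/-- Moving from `x` towards `p` along the submanifold, the distance to `p` decreases at a definite
rate compared to the change of the tangent space. -/
lemma IsLocalParam.exists_closer [CompactSpace M] {x p : M} {σ : E → M} {a₀ : E}
    (h : IsLocalParam ι T x σ a₀) (hι : IsEmbedding ι) {L : ℝ} (hL₀ : 0 < L)
    (hL : ∀ y ∈ medialAxis (Set.range ι), L ≤ dist (ι p) y) (hxp : ι x ≠ ι p)
    (hd : ‖ι x - ι p‖ ≤ L / 4) {u : F} (hu : ‖u‖ = 1) :
    ∃ y, ‖ι y - ι p‖ < ‖ι x - ι p‖ ∧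
      ‖(T x)ᗮ.starProjection u‖ - 3 / (2 * L) * ‖ι x - ι p‖ <
      ‖(T y)ᗮ.starProjection u‖ - 3 / (2 * L) * ‖ι y - ι p‖ := by
  set D := ‖ι x - ι p‖ with hD
  have hDpos : 0 < D := norm_pos_iff.2 (sub_ne_zero.2 hxp)
  -- Since `x` is within L/4 of `p`, it is at least 3L/4 from the medial axis.
  have hL'pos : 0 < 3 * L / 4 := by linarith
  have hfed : ∀ n ∈ (T x)ᗮ, ‖n‖ = 1 → ∀ y,
      2 * (3 * L / 4) * inner ℝ (ι y - ι x) n ≤ ‖ι y - ι x‖ ^ 2 := by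
    intro n hn hn1 y
    refine h.two_mul_inner_le hι hL'pos.le (fun y hy => ?_) hn hn1 y
    have h1 := hL y hy
    have h2 := dist_triangle (ι p) (ι x) y
    rw [dist_comm (ι p) (ι x), dist_eq_norm (ι x)] at h2
    linarith
  set φ := ι ∘ σ with hφ
  have hTx : T x = (fderiv ℝ φ a₀).range := by
    rw [← h.eventually_eq.self_of_nhds, h.apply_eq]
  have hφx : φ a₀ = ι x := by rw [hφ, Function.comp_apply, h.apply_eq]
  obtain ⟨v, hv⟩ : (T x).starProjection (ι p - ι x) ∈ (fderiv ℝ φ a₀).range := by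
    rw [← hTx]; exact Submodule.starProjection_apply_mem _ _
  change fderiv ℝ φ a₀ v = _ at hv
  have hN : ‖(T x)ᗮ.starProjection (ι p - ι x)‖ ≤ D / 6 := by
    refine norm_starProjection_orthogonal_le (by positivity) fun n hn hn1 => ?_
    have h1 := hfed n hn hn1 p
    rw [norm_sub_rev, ← hD] at h1
    have h2 : D ^ 2 ≤ L / 4 * D := by nlinarith
    have h3 : L * (6 * inner ℝ (ι p - ι x) n) ≤ L * D := by linarith
    linarith [le_of_mul_le_mul_left h3 hL₀]
  have hpyth : ‖fderiv ℝ φ a₀ v‖ ^ 2 + ‖(T x)ᗮ.starProjection (ι p - ι x)‖ ^ 2 = D ^ 2 := by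
    rw [hv, hD, norm_sub_rev (ι x)]
    exact (Submodule.norm_sq_eq_add_norm_sq_starProjection (ι p - ι x) (T x)).symm
  have hAle : ‖fderiv ℝ φ a₀ v‖ ≤ D := by
    refine abs_le_of_sq_le_sq' ?_ hDpos.le |>.2
    linarith [sq_nonneg ‖(T x)ᗮ.starProjection (ι p - ι x)‖]
  have hAge : 35 / 36 * D ^ 2 ≤ ‖fderiv ℝ φ a₀ v‖ ^ 2 := by
    have : ‖(T x)ᗮ.starProjection (ι p - ι x)‖ ^ 2 ≤ (D / 6) ^ 2 := by gcongr
    linarith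
  have hv0 : v ≠ 0 := by
    rintro rfl
    rw [map_zero, norm_zero] at hAge
    nlinarith
  have hinner : inner ℝ (φ a₀ - ι p) (fderiv ℝ φ a₀ v) = -‖fderiv ℝ φ a₀ v‖ ^ 2 := by
    have h1 : inner ℝ (ι p - ι x - (T x).starProjection (ι p - ι x))
        ((T x).starProjection (ι p - ι x)) = 0 :=
      Submodule.inner_left_of_mem_orthogonal (Submodule.starProjection_apply_mem _ _)
        (Submodule.sub_starProjection_mem_orthogonal _)
    rw [inner_sub_left, real_inner_self_eq_norm_sq] at h1
    rw [hφx, ← neg_sub (ι p), inner_neg_left, hv]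
    linarith
  -- The exact rate is ‖A v‖²/D ≥ 35/36 D, above 14/15 D.
  have hcloser : ∀ᶠ τ in 𝓝[>] (0 : ℝ), ‖φ (a₀ + τ • v) - ι p‖ < D - 14 / 15 * D * τ := by
    have h0 : φ (a₀ + (0 : ℝ) • v) = ι x := by rw [zero_smul, add_zero, hφx]
    have h1 := eventually_norm_sub_le (κ := 14 / 15 * D) (p := ι p)
      (hasDerivAt_comp_add_smul_zero (ψ := φ) v (h.contDiffAt.differentiableAt (by simp)))
      (by rw [h0]; exact hxp) (by rw [h0, ← hφx, hinner, hφx]; nlinarith)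
    rwa [h0] at h1
  have hturn := eventually_norm_starProjection_le (φ := φ) h.contDiffAt h.injective hL'pos
    (Filter.Eventually.of_forall fun a n hn hn1 => by
      rw [hφx]; exact hfed n (by rwa [hTx]) hn1 (σ a))
    -- 7/5 exceeds 4/3, the bound from radius 3L/4, and equals 3/2 · 14/15: the loss in angle is
    -- paid for by the gain in distance.
    (K := 7 / (5 * L)) (by rw [div_lt_div_iff₀ (by positivity) (by positivity)]; linarith) hv0
  have hl : Filter.Tendsto (fun h : ℝ => a₀ + h • v) (𝓝[>] 0) (𝓝 a₀) := by
    have := (hasDerivAt_add_smul a₀ v 0).continuousAt.tendsto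
    rw [zero_smul, add_zero] at this
    exact this.mono_left nhdsWithin_le_nhds
  obtain ⟨τ, hτ1, hτ2, hτ3, hτ0⟩ := (hcloser.and (hturn.and
    ((hl.eventually h.eventually_eq).and self_mem_nhdsWithin))).exists
  set y := σ (a₀ + τ • v) with hy
  change ‖ι y - ι p‖ < _ at hτ1
  change T y = (fderiv ℝ φ (a₀ + τ • v)).range at hτ3
  simp only [← hTx, ← hτ3] at hτ2
  refine ⟨y, by nlinarith, ?_⟩
  have hψ : ‖(T x)ᗮ.starProjection u‖ ≤
      τ * (7 / (5 * L) * D) + ‖(T y)ᗮ.starProjection u‖ := by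
    have h1 := Submodule.starProjection_add_starProjection_orthogonal (K := T y) u
    calc ‖(T x)ᗮ.starProjection u‖
        = ‖(T x)ᗮ.starProjection ((T y).starProjection u)
          + (T x)ᗮ.starProjection ((T y)ᗮ.starProjection u)‖ := by rw [← map_add, h1]
      _ ≤ _ := norm_add_le _ _
      _ ≤ _ := by
        refine add_le_add ?_ (Submodule.norm_starProjection_apply_le _ _)
        refine (hτ2 _ (Submodule.starProjection_apply_mem _ _)).trans ?_
        have h2 := Submodule.norm_starProjection_apply_le (T y) u
        rw [hu] at h2
        calc _ ≤ τ * (7 / (5 * L) * D) * 1 := by gcongr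
          _ = _ := mul_one _
  have h3 : 3 / (2 * L) * ‖ι y - ι p‖ < 3 / (2 * L) * (D - 14 / 15 * D * τ) := by gcongr
  have h4 : 3 / (2 * L) * (D - 14 / 15 * D * τ) = 3 / (2 * L) * D - τ * (7 / (5 * L) * D) := by
    field_simp
    ring
  linarith

/-- Tangent variation: tangent vectors at `p` deviate from the tangent space at `q` by at most
`3 / (2 * L)` times the distance, where `L` bounds the local feature size at `p` from below. -/
theorem norm_starProjection_orthogonal_tangent_le [CompactSpace M] (hι : IsEmbedding ι)
    (hparam : ∀ x, ∃ (σ : E → M) (a₀ : E), IsLocalParam ι T x σ a₀) {p q : M} {L : ℝ} (hL₀ : 0 < L)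
    (hL : ∀ y ∈ medialAxis (Set.range ι), L ≤ dist (ι p) y) (hpq : ‖ι q - ι p‖ ≤ L / 4) {u : F}
    (hu : ‖u‖ = 1) (huT : u ∈ T p) :
    ‖(T q)ᗮ.starProjection u‖ ≤ 3 / (2 * L) * ‖ι q - ι p‖ := by
  have husc : UpperSemicontinuous fun x => ‖(T x)ᗮ.starProjection u‖ := by
    intro x r hr
    obtain ⟨σ, a₀, h⟩ := hparam x
    rw [← h.map_nhds, Filter.eventually_map]
    have h1 : ContDiffAt ℝ 1 (fderiv ℝ (ι ∘ σ)) a₀ :=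
      h.contDiffAt.fderiv_right (by norm_num [one_add_one_eq_two])
    simp only [← h.apply_eq, h.eventually_eq.self_of_nhds] at hr
    filter_upwards [h.eventually_eq, eventually_norm_starProjection_lt h1.continuousAt u hr]
      with a ha hb
    simp only [ha]
    exact hb
  have hcont : Continuous fun x => ‖ι x - ι p‖ := (hι.continuous.sub continuous_const).norm
  have husc' : UpperSemicontinuous fun x =>
      ‖(T x)ᗮ.starProjection u‖ + -(3 / (2 * L) * ‖ι x - ι p‖) :=
    husc.add (continuous_const.mul hcont).neg.upperSemicontinuous
  have hK : IsCompact {x | ‖ι x - ι p‖ ≤ ‖ι q - ι p‖} :=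
    (isClosed_le hcont continuous_const).isCompact
  obtain ⟨x, hx, hmax⟩ := (husc'.upperSemicontinuousOn _).exists_isMaxOn
    ⟨q, (le_rfl : ‖ι q - ι p‖ ≤ _)⟩ hK
  rw [Set.mem_ofPred_eq] at hx
  have hq := hmax (show q ∈ {x | ‖ι x - ι p‖ ≤ ‖ι q - ι p‖} from (le_rfl : ‖ι q - ι p‖ ≤ _))
  simp only [Set.mem_ofPred_eq] at hq
  rcases eq_or_ne x p with rfl | hne
  · rw [starProjection_orthogonal_eq_zero _ huT] at hq
    simp only [norm_zero, sub_self, mul_zero, neg_zero, add_zero] at hq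
    linarith
  · obtain ⟨σ, a₀, h⟩ := hparam x
    obtain ⟨y, hy1, hy2⟩ := h.exists_closer hι hL₀ hL (hι.injective.ne hne) (hx.trans hpq) hu
    have := hmax (show y ∈ {x | ‖ι x - ι p‖ ≤ ‖ι q - ι p‖} from hy1.le.trans hx)
    rw [Set.mem_ofPred_eq] at this
    linarith

end Submanifold

/-! ### From normal components to angles -/

section Angle

variable {F : Type*} [NormedAddCommGroup F] [InnerProductSpace ℝ F]

lemma subspaceAngle_nonneg (U V : Submodule ℝ F) : 0 ≤ subspaceAngle U V :=
  Real.iSup_nonneg fun _ => Real.iInf_nonneg fun _ => InnerProductGeometry.angle_nonneg _ _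

/-- The normalized projection of `u` to `V` is a competitor in the infimum, at angle arcsin of the
normal part; s < 1 keeps that projection nonzero. -/
lemma sin_subspaceAngle_le {U V : Submodule ℝ F} [V.HasOrthogonalProjection] {s : ℝ} (hs0 : 0 ≤ s)
    (hs1 : s < 1) (h : ∀ u ∈ U, ‖u‖ = 1 → ‖Vᗮ.starProjection u‖ ≤ s) :
    Real.sin (subspaceAngle U V) ≤ s := by
  have hle : subspaceAngle U V ≤ Real.arcsin s := by
    refine Real.iSup_le (fun u => ?_) (Real.arcsin_nonneg.2 hs0)
    obtain ⟨u, hu, hu1⟩ := u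
    have hN := h u hu hu1
    have hpyth := Submodule.norm_sq_eq_add_norm_sq_starProjection u V
    rw [hu1] at hpyth
    set w := V.starProjection u with hw
    have hwpos : 0 < ‖w‖ := by
      by_contra! h0
      have h1 : ‖w‖ = 0 := le_antisymm h0 (norm_nonneg _)
      rw [h1] at hpyth
      nlinarith [norm_nonneg (Vᗮ.starProjection u)]
    have hwV : w ∈ V := Submodule.starProjection_apply_mem _ _
    have hinner : inner ℝ u w = ‖w‖ ^ 2 := by
      have h3 : inner ℝ (u - w) w = 0 :=
        Submodule.inner_left_of_mem_orthogonal hwV (Submodule.sub_starProjection_mem_orthogonal u)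
      rw [inner_sub_left, real_inner_self_eq_norm_sq] at h3
      linarith
    refine (ciInf_le ⟨0, ?_⟩ ⟨‖w‖⁻¹ • w, V.smul_mem _ hwV, by
      rw [norm_smul, norm_inv, norm_norm, inv_mul_cancel₀ hwpos.ne']⟩).trans ?_
    · rintro _ ⟨v, rfl⟩
      exact InnerProductGeometry.angle_nonneg _ _
    · rw [InnerProductGeometry.angle_smul_right_of_pos _ _ (inv_pos.2 hwpos),
        InnerProductGeometry.angle, hinner, hu1, one_mul, sq, mul_div_assoc,
        div_self hwpos.ne', mul_one, Real.arccos_eq_arcsin hwpos.le]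
      refine Real.arcsin_le_arcsin (Real.sqrt_le_iff.2 ⟨hs0, ?_⟩)
      nlinarith [norm_nonneg (Vᗮ.starProjection u)]
  have := Real.sin_le_sin_of_le_of_le_pi_div_two
    (by linarith [subspaceAngle_nonneg U V, Real.pi_pos]) (Real.arcsin_le_pi_div_two s) hle
  rwa [Real.sin_arcsin (by linarith) hs1.le] at this

end Angle

/-! ### Smooth embeddings and the final bounds -/

lemma exists_isLocalParam {m N : ℕ} {M : Type*} [TopologicalSpace M]
    [ChartedSpace (EuclideanSpace ℝ (Fin m)) M] [IsManifold (𝓡 m) ∞ M]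
    {ι : M → EuclideanSpace ℝ (Fin N)} (hι : IsSmoothEmbedding (𝓡 m) (𝓡 N) ∞ ι) (x : M) :
    ∃ (σ : EuclideanSpace ℝ (Fin m) → M) (a₀ : EuclideanSpace ℝ (Fin m)),
      IsLocalParam ι (tangentSubspace (m := m) ι) x σ a₀ := by
  have him := hι.isImmersion.isImmersionAt x
  set e := him.domChart with he
  have hx : x ∈ e.source := him.mem_domChart_source
  have hsymm := contMDiffOn_symm_of_mem_maximalAtlas him.domChart_mem_maximalAtlas
  have hcont : ContMDiff (𝓡 m) (𝓡 N) ∞ ι := hι.contMDiff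
  have hmd : e.MDifferentiable (𝓡 m) (𝓡 m) :=
    ⟨(contMDiffOn_of_mem_maximalAtlas him.domChart_mem_maximalAtlas).mdifferentiableOn (by simp),
      hsymm.mdifferentiableOn (by simp)⟩
  have hsm : ∀ a ∈ e.target, ContDiffAt ℝ ∞ (ι ∘ e.symm) a := fun a ha => by
    rw [← contMDiffAt_iff_contDiffAt]
    exact hcont.contMDiffAt.comp a (hsymm.contMDiffAt (e.open_target.mem_nhds ha))
  have ha₀ : e x ∈ e.target := e.map_source hx
  refine ⟨e.symm, e x, e.left_inv hx, ?_,
    (hsm _ ha₀).of_le (WithTop.coe_le_coe.2 (le_top : (2 : ℕ∞) ≤ ⊤)), ?_, ?_⟩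
  · rw [e.symm.map_nhds_eq ha₀, e.left_inv hx]
  -- In immersion charts, `ι` is a linear inclusion followed by an isomorphism, so the chain rule
  -- forces the differential to be injective.
  · set ψ := him.codChart.extend (𝓡 N) with hψ
    have hψd : DifferentiableAt ℝ ψ ((ι ∘ e.symm) (e x)) := by
      have h1 := (OpenPartialHomeomorph.contMDiffOn_extend (I := 𝓡 N)
        him.codChart_mem_maximalAtlas).contMDiffAt
          (him.codChart.open_source.mem_nhds him.mem_codChart_source)
      rw [contMDiffAt_iff_contDiffAt] at h1
      rw [Function.comp_apply, e.left_inv hx]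
      exact h1.differentiableAt (by simp)
    have hcomp := hψd.hasFDerivAt.comp (e x) ((hsm _ ha₀).differentiableAt (by simp)).hasFDerivAt
    have hlin : HasFDerivAt (ψ ∘ ι ∘ e.symm) ((him.equiv.toContinuousLinearMap).comp
        (ContinuousLinearMap.inl ℝ (EuclideanSpace ℝ (Fin m)) him.complement)) (e x) := by
      refine HasFDerivAt.congr_of_eventuallyEq (ContinuousLinearMap.hasFDerivAt _) ?_
      filter_upwards [e.open_target.mem_nhds ha₀] with a ha
      exact him.writtenInCharts (by simpa using ha)
    have huniq := hcomp.unique hlin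
    have hinj : Function.Injective ((him.equiv.toContinuousLinearMap).comp
        (ContinuousLinearMap.inl ℝ (EuclideanSpace ℝ (Fin m)) him.complement)) :=
      him.equiv.injective.comp (LinearMap.inl_injective (R := ℝ))
    rw [← huniq] at hinj
    exact Function.Injective.of_comp hinj
  · filter_upwards [e.open_target.mem_nhds ha₀] with a ha
    have h1 : mfderiv (𝓡 m) (𝓡 N) (ι ∘ e.symm) a =
        (mfderiv (𝓡 m) (𝓡 N) ι (e.symm a)).comp (mfderiv (𝓡 m) (𝓡 m) e.symm a) :=
      mfderiv_comp a (hcont.mdifferentiableAt (by simp))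
        ((hsymm.contMDiffAt (e.open_target.mem_nhds ha)).mdifferentiableAt (by simp))
    rw [mfderiv_eq_fderiv] at h1
    have h2 : Function.Surjective (mfderiv (𝓡 m) (𝓡 m) e.symm a) := hmd.symm.mfderiv_surjective ha
    apply SetLike.coe_injective
    have h3 : Set.range (fderiv ℝ (ι ∘ e.symm) a) =
        Set.range (mfderiv (𝓡 m) (𝓡 N) ι (e.symm a)) := by
      rw [h1]
      exact h2.range_comp _
    exact h3.symm

/-- The tangent variation bound with the constant `3 / 2`. -/
lemma sin_subspaceAngle_tangentSubspace_le {m N : ℕ} {M : Type*} [TopologicalSpace M]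
    [ChartedSpace (EuclideanSpace ℝ (Fin m)) M] [IsManifold (𝓡 m) ∞ M] [CompactSpace M]
    {ι : M → EuclideanSpace ℝ (Fin N)} (hι : IsSmoothEmbedding (𝓡 m) (𝓡 N) ∞ ι) {p q : M} {t : ℝ}
    (ht0 : 0 ≤ t) (ht : t ≤ 1 / 4)
    (hpq : edist (ι p) (ι q) = ENNReal.ofReal t * lfs (Set.range ι) (ι p)) :
    Real.sin (subspaceAngle (tangentSubspace (m := m) ι p) (tangentSubspace (m := m) ι q)) ≤
      3 / 2 * t := by
  rcases eq_or_ne p q with rfl | hne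
  · refine (sin_subspaceAngle_le le_rfl one_pos fun u hu _ => ?_).trans (by positivity)
    rw [starProjection_orthogonal_eq_zero _ hu, norm_zero]
  have hpos : edist (ι p) (ι q) ≠ 0 := by
    rw [Ne, edist_eq_zero]; exact hι.isEmbedding.injective.ne hne
  have hlfs0 : lfs (Set.range ι) (ι p) ≠ 0 := fun h => hpos (by rw [hpq, h, mul_zero])
  have ht_pos : ENNReal.ofReal t ≠ 0 := fun h => hpos (by rw [hpq, h, zero_mul])
  -- For p ≠ q the factor `t` is positive, so an infinite feature size would make the distance
  -- infinite.
  have hlfs1 : lfs (Set.range ι) (ι p) ≠ ⊤ := fun h => edist_ne_top (ι p) (ι q) (by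
    rw [hpq, h, ENNReal.mul_top ht_pos])
  set L := (lfs (Set.range ι) (ι p)).toReal with hL
  have hLpos : 0 < L := ENNReal.toReal_pos hlfs0 hlfs1
  have hdist : ‖ι q - ι p‖ = t * L := by
    rw [← dist_eq_norm, dist_comm, dist_edist, hpq, ENNReal.toReal_mul, ENNReal.toReal_ofReal ht0]
  refine sin_subspaceAngle_le (by positivity) (by linarith) fun u hu hu1 => ?_
  refine (norm_starProjection_orthogonal_tangent_le hι.isEmbedding (exists_isLocalParam hι) hLpos
    (fun y hy => ?_) (by rw [hdist]; nlinarith) hu1 hu).trans_eq ?_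
  · rw [hL, dist_edist]
    exact ENNReal.toReal_mono (edist_ne_top _ _) (Metric.infEDist_le_edist_of_mem hy)
  · rw [hdist]
    field_simp

lemma f_sub_isBigO : (fun t : ℝ => f t - 9 / 2) =O[𝓝 0] fun t : ℝ => t := by
  have hd : DifferentiableAt ℝ f 0 := by
    unfold f
    exact DifferentiableAt.div (by fun_prop) (by fun_prop) (by norm_num)
  have h := hd.isBigO_sub
  simpa [show f 0 = 9 / 2 by norm_num [f]] using h

lemma f_lt_six {t : ℝ} (h0 : 0 ≤ t) (h1 : t ≤ 1 / 10) : f t < 6 := by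
  rw [f, div_lt_iff₀ (by linarith)]
  have h2 : (2 + 3 * t + 2 * t ^ 2) ≤ 2 + 32 / 10 * t := by nlinarith
  have h3 : (2 + 3 * t + 2 * t ^ 2) ^ 2 ≤ (2 + 32 / 10 * t) ^ 2 := by gcongr
  nlinarith

lemma three_halves_le_f {t : ℝ} (h0 : 0 ≤ t) (h1 : t ≤ 1 / 4) : 3 / 2 ≤ f t := by
  rw [f, le_div_iff₀ (by linarith)]
  nlinarith [sq_nonneg (2 + 3 * t + 2 * t ^ 2)]

end TangentVariation

theorem theorem1 :
    (∀ (m N : ℕ) (M : Type*) [TopologicalSpace M] [ChartedSpace (EuclideanSpace ℝ (Fin m)) M]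
        [IsManifold (𝓡 m) ∞ M] [CompactSpace M] (ι : M → EuclideanSpace ℝ (Fin N)),
        IsSmoothEmbedding (𝓡 m) (𝓡 N) ∞ ι →
        ∀ (p q : M) (t : ℝ), 0 ≤ t → t ≤ 1 / 4 →
          edist (ι p) (ι q) = ENNReal.ofReal t * TangentVariation.lfs (Set.range ι) (ι p) →
          Real.sin (TangentVariation.subspaceAngle (TangentVariation.tangentSubspace (m := m) ι p)
            (TangentVariation.tangentSubspace (m := m) ι q)) ≤ t * TangentVariation.f t) ∧
    ((fun t : ℝ => TangentVariation.f t - 9 / 2) =O[𝓝 0] fun t : ℝ => t) ∧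
    (∀ t : ℝ, 0 ≤ t → t ≤ 1 / 10 → TangentVariation.f t < 6) ∧
    (∃ C : ℝ, ∀ (m N : ℕ) (M : Type*) [TopologicalSpace M]
        [ChartedSpace (EuclideanSpace ℝ (Fin m)) M]
        [IsManifold (𝓡 m) ∞ M] [CompactSpace M] (ι : M → EuclideanSpace ℝ (Fin N)),
        IsSmoothEmbedding (𝓡 m) (𝓡 N) ∞ ι →
        ∀ (p q : M) (t : ℝ), 0 ≤ t → t ≤ 19 / 200 →
          edist (ι p) (ι q) = ENNReal.ofReal t * TangentVariation.lfs (Set.range ι) (ι p) →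
          Real.sin (TangentVariation.subspaceAngle (TangentVariation.tangentSubspace (m := m) ι p)
            (TangentVariation.tangentSubspace (m := m) ι q)) ≤ 3 * t + C * t ^ 2) := by
  refine ⟨?_, TangentVariation.f_sub_isBigO, fun t => TangentVariation.f_lt_six, 0, ?_⟩
  · intro m N M _ _ _ _ ι hι p q t h0 h1 hpq
    refine (TangentVariation.sin_subspaceAngle_tangentSubspace_le hι h0 h1 hpq).trans ?_
    rw [mul_comm]
    exact mul_le_mul_of_nonneg_left (TangentVariation.three_halves_le_f h0 h1) h0
  · intro m N M _ _ _ _ ι hι p q t h0 h1 hpq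
    have := TangentVariation.sin_subspaceAngle_tangentSubspace_le hι h0 (by linarith) hpq
    linarith
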